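/- Let $T>0$, $p\ge 1$, $d\ge 0$. Let $\hat V^p$ be the space of $p$-rough paths $\hat{\mathbf X}^{\le p}$ (continuous multiplicative functionals $(1,X^1,\dots,X^{\lfloor p\rfloor})$ on $\{0\le s\le t\le T\}$, not necessarily geometric, each level of finite $p$-variation) over time-extended paths $\hat X_t=(t,X_t)$, $X_t\in\mathbb R^d$, with the topology of the $p$-variation distance. Write $\hat{\mathbf X}^{\le\infty}$ for the signature over $[0,T]$ (the unique extension of $\hat{\mathbf X}^{\le p}$ to a multiplicative functional with values in $T((\mathbb R^{d+1}))$ and finite $p$-variation in every level, evaluated at $(0,T)$), and $\langle\pi,\hat{\mathbf X}^{\le\infty}\rangle$ for its pairing with a weighted word $\pi\in T(\mathbb R^{d+1})$. Let $F:\hat V^p\to\mathbb R$ be a continuous payoff functional for which there are weighted words $\pi_1,\dots,\pi_n$ and a function $f:\mathbb R^n\to\mathbb R$ with $$F(\hat{\mathbf X}^{\le p})=f\big(g(\hat{\mathbf X}^{\le p})\big),\qquad g(\hat{\mathbf X}^{\le p}):=\big(\langle\pi_1,\hat{\mathbf X}^{\le\infty}\rangle,\dots,\langle\pi_n,\hat{\mathbf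 X}^{\le\infty}\rangle\big),\qquad\text{for all }\hat{\mathbf X}^{\le p}\in\hat V^p.$$ Let $\hat{\mathbf X}^{\le p}$ be a random price path, that is, a measurable map from a probability space to $\hat V^p$, such that the price $\mathrm{pr}=\mathbb E[F(\hat{\mathbf X}^{\le p})]$ and all signature correlators $\rho_m=\mathbb E\big[g(\hat{\mathbf X}^{\le p})^m\big]$, $m\in\mathbb N^n$ (where $x^m=x_1^{m_1}\cdots x_n^{m_n}$), exist as expectations of integrable random variables. Then for every $\epsilon>0$ there are a finite set $\mathcal N\subset\mathbb N^n$ and real numbers $(\alpha_m)_{m\in\mathcal N}$ with $$\Big|\mathrm{pr}-\sum_{m\in\mathcal N}\alpha_m\rho_m\Big|<\epsilon .$$ Moreover, for any compact set $K\subset\mathbb R^n$ on which $f$ is continuous (so for every compact $K$ if $f$ is continuous), $\mathcal N$ and $(\alpha_m)$ can be chosen such that, in addition, the same polynomial approximates the payoff: $$\Big|F(\hat{\mathbf Y}^{\le p})-\sum_{m\in\mathcal N}\alpha_m\, g(\hat{\mathbf Y}^{\le p})^m\Big|<\epsilon\qquad\text{for all }\hat{\mathbf Y}^{\le p}\in\hat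 V^p\text{ with }g(\hat{\mathbf Y}^{\le p})\in K .$$ -/

import Mathlib

open MeasureTheory
open scoped ENNReal

noncomputable section

namespace SigPricing

/-- Elements of the extended tensor algebra `T((ℝᵉ))`, in coordinates: the coefficient of
`e_{i₁} ⊗ ⋯ ⊗ e_{iₙ}` is the value at the word `i₁ ⋯ iₙ`. -/
abbrev Tensor (e : ℕ) : Type := List (Fin e) → ℝ

/-- Weighted words `∑ a_w w` (finite sums), that is, elements of `ℝ⟨𝒜⟩ ≃ T(ℝᵉ)`. -/
abbrev WeightedWord (e : ℕ) : Type := List (Fin e) →₀ ℝ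

/-- The dual pairing `⟨π, x⟩ = ∑ a_w x_w` of a weighted word with an element of `T((ℝᵉ))`. -/
def pairing {e : ℕ} (π : WeightedWord e) (x : Tensor e) : ℝ := π.sum fun w a => a * x w

/-- The tensor product of `T((ℝᵉ))`: the coefficient of `w` is `∑_{w = uv} x_u y_v`. -/
def tensorMul {e : ℕ} (x y : Tensor e) : Tensor e := fun w =>
  ∑ k ∈ Finset.range (w.length + 1), x (w.take k) * y (w.drop k)

/-- The Euclidean norm of the component of `x` in `(ℝᵉ)^{⊗ i}`. -/
def levelNorm {e : ℕ} (i : ℕ) (x : Tensor e) : ℝ :=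
  Real.sqrt (∑ v : Fin i → Fin e, x (List.ofFn v) ^ 2)

/-- The simplex `{(s, t) : 0 ≤ s ≤ t ≤ T}`. -/
abbrev Simplex (T : ℝ) : Type := {q : Set.Icc (0 : ℝ) T × Set.Icc (0 : ℝ) T // q.1 ≤ q.2}

/-- The pair `(0, T)`. -/
def Simplex.full {T : ℝ} (hT : 0 ≤ T) : Simplex T :=
  ⟨(⟨0, le_refl 0, hT⟩, ⟨T, hT, le_refl T⟩), hT⟩

/-- Multiplicative functionals of degree `N`; for `N = ⊤` they take values in `T((ℝᵉ))`, for
finite `N` in the truncated tensor algebra (levels `0, …, N`). -/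
structure IsMultiplicative {e : ℕ} (T : ℝ) (N : ℕ∞) (X : Simplex T → Tensor e) : Prop where
  scalar : ∀ q, X q [] = 1
  truncated : ∀ q (w : List (Fin e)), N < (w.length : ℕ∞) → X q w = 0
  continuous : ∀ w, Continuous fun q => X q w
  chen : ∀ (s u t : Set.Icc (0 : ℝ) T) (hsu : s ≤ u) (hut : u ≤ t) (w : List (Fin e)),
    (w.length : ℕ∞) ≤ N →
      X ⟨(s, t), hsu.trans hut⟩ w = tensorMul (X ⟨(s, u), hsu⟩) (X ⟨(u, t), hut⟩) w

/-- `sup_P ∑ |Aⁱ_{t_k, t_{k+1}}|^{p/i}` over the finite partitions `t_0 ≤ t_1 ≤ ⋯ ≤ t_n` of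
`[0, T]`. -/
def levelVariation {e : ℕ} {T : ℝ} (p : ℝ) (i : ℕ) (A : Simplex T → Tensor e) : ℝ≥0∞ :=
  ⨆ (n : ℕ) (t : Fin (n + 1) →o Set.Icc (0 : ℝ) T),
    ∑ k : Fin n, ENNReal.ofReal
      (levelNorm i (A ⟨(t k.castSucc, t k.succ), t.monotone (Fin.castSucc_lt_succ).le⟩)
        ^ (p / (i : ℝ)))

/-- `p`-rough paths: multiplicative functionals of degree `⌊p⌋` with finite `p`-variation. -/
structure IsRoughPath {e : ℕ} (T p : ℝ) (X : Simplex T → Tensor e) : Prop where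
  multiplicative : IsMultiplicative T (⌊p⌋₊ : ℕ∞) X
  finiteVariation : ∀ i : ℕ, 1 ≤ i → i ≤ ⌊p⌋₊ → levelVariation p i X < ⊤

/-- The space of `p`-rough paths over time-extended paths `t ↦ (t, X_t)`, `X_t ∈ ℝᵈ`.
The letter `0` is time, the letters `1, …, d` are the components of `X`. -/
def TimeRoughPath (T p : ℝ) (d : ℕ) : Type :=
  {X : Simplex T → Tensor (d + 1) //
    IsRoughPath T p X ∧ ∀ q : Simplex T, X q [0] = (q.1.2 : ℝ) - (q.1.1 : ℝ)}

/-- The `p`-variation distance `max_{1 ≤ i ≤ ⌊p⌋} (sup_P ∑ |Xⁱ - Yⁱ|^{p/i})^{i/p}`. -/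
def pVarDist {T p : ℝ} {d : ℕ} (X Y : TimeRoughPath T p d) : ℝ≥0∞ :=
  ⨆ i ∈ Finset.Icc 1 ⌊p⌋₊,
    levelVariation p i (fun q w => X.1 q w - Y.1 q w) ^ ((i : ℝ) / p)

/-- The topology of the `p`-variation distance. -/
instance {T p : ℝ} {d : ℕ} : TopologicalSpace (TimeRoughPath T p d) where
  IsOpen U := ∀ X ∈ U, ∃ δ : ℝ≥0∞, 0 < δ ∧ ∀ Y, pVarDist X Y < δ → Y ∈ U
  isOpen_univ := fun _ _ => ⟨1, one_pos, fun _ _ => trivial⟩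
  isOpen_inter := by
    intro U V hU hV X hX
    obtain ⟨a, ha, hUa⟩ := hU X hX.1
    obtain ⟨b, hb, hVb⟩ := hV X hX.2
    exact ⟨min a b, lt_min ha hb, fun Y hY =>
      ⟨hUa Y (hY.trans_le (min_le_left a b)), hVb Y (hY.trans_le (min_le_right a b))⟩⟩
  isOpen_sUnion := by
    intro S hS X hX
    obtain ⟨U, hUS, hXU⟩ := hX
    obtain ⟨a, ha, h⟩ := hS U hUS X hXU
    exact ⟨a, ha, fun Y hY => ⟨U, hUS, h Y hY⟩⟩

instance {T p : ℝ} {d : ℕ} : MeasurableSpace (TimeRoughPath T p d) := borel _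

instance {T p : ℝ} {d : ℕ} : BorelSpace (TimeRoughPath T p d) := ⟨rfl⟩

/-- `S` is an extension of the `p`-rough path `X` to a multiplicative functional with values in
`T((ℝᵉ))` all of whose levels have finite `p`-variation. -/
structure IsSignature {e : ℕ} {T : ℝ} (p : ℝ) (X S : Simplex T → Tensor e) : Prop where
  multiplicative : IsMultiplicative T ⊤ S
  finiteVariation : ∀ i : ℕ, 1 ≤ i → levelVariation p i S < ⊤
  extends_path : ∀ q (w : List (Fin e)), w.length ≤ ⌊p⌋₊ → S q w = X q w

open Classical in
/-- The signature of `X`: its extension in the sense of `IsSignature`. By Lyons' extension theorem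
it exists and is unique for every `p`-rough path with `p ≥ 1`, so the value `0` is never taken. -/
def signature {T p : ℝ} {d : ℕ} (X : TimeRoughPath T p d) : Simplex T → Tensor (d + 1) :=
  if h : ∃ S, IsSignature p X.1 S then h.choose else 0

/-- The coordinates `(⟨π₁, X⟩, …, ⟨πₙ, X⟩)` of the signature of `X` over `[0, T]`. -/
def sigCoords {T p : ℝ} {d n : ℕ} (hT : 0 ≤ T) (π : Fin n → WeightedWord (d + 1))
    (X : TimeRoughPath T p d) : Fin n → ℝ :=
  fun i => pairing (π i) (signature X (Simplex.full hT))

/-- The monomial `x^m = x₁^{m₁} ⋯ xₙ^{mₙ}`. -/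
def monomial {n : ℕ} (x : Fin n → ℝ) (m : Fin n → ℕ) : ℝ := ∏ i, x i ^ m i

/-- `F` is a continuous payoff functional that is a function `f` of the signature coordinates
given by the weighted words `π₁, …, πₙ`. -/
structure IsSignaturePayoff {T p : ℝ} {d n : ℕ} (hT : 0 ≤ T) (F : TimeRoughPath T p d → ℝ)
    (π : Fin n → WeightedWord (d + 1)) (f : (Fin n → ℝ) → ℝ) : Prop where
  continuous : Continuous F
  eq_comp : ∀ X, F X = f (sigCoords hT π X)

/-- The signature correlator `ρ_m = 𝔼[(⟨π₁, X⟩, …, ⟨πₙ, X⟩)^m]`. -/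
def correlator {Ω : Type*} [MeasurableSpace Ω] (P : Measure Ω) {T p : ℝ} {d n : ℕ} (hT : 0 ≤ T)
    (π : Fin n → WeightedWord (d + 1)) (X : Ω → TimeRoughPath T p d) (m : Fin n → ℕ) : ℝ :=
  ∫ ω, monomial (sigCoords hT π (X ω)) m ∂P

/-- The price `𝔼[F(X)]` of the payoff `F`. -/
def price {Ω : Type*} [MeasurableSpace Ω] (P : Measure Ω) {T p : ℝ} {d : ℕ}
    (F : TimeRoughPath T p d → ℝ) (X : Ω → TimeRoughPath T p d) : ℝ :=
  ∫ ω, F (X ω) ∂P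

end SigPricing

end

namespace SigPricing

/-! Let `G` be the random vector of signature coordinates. Stone–Weierstrass yields a polynomial `q`
close to `f` on `K`, which says nothing about the expectation if `G` leaves `K`. Either `G ∈ K`
almost surely, and then `q` also gives the price; or `r ↦ 𝔼[r(G)]` is unbounded on the polynomials
with `|r| ≤ 1` on `K` (`ae_mem_of_integral_eval_le`, contraposed), and a small multiple of such an
`r` repairs the expectation of `q` while barely changing it on `K`. So neither continuity of `f` off
`K` nor moment determinacy is needed. -/

/-- **Stone–Weierstrass** for multivariate polynomials on a compact set. -/
theorem exists_mvPolynomial_near {n : ℕ} {K : Set (Fin n → ℝ)} (hK : IsCompact K)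
    {f : (Fin n → ℝ) → ℝ} (hf : ContinuousOn f K) {ε : ℝ} (hε : 0 < ε) :
    ∃ q : MvPolynomial (Fin n) ℝ, ∀ x ∈ K, |MvPolynomial.eval x q - f x| < ε := by
  have : CompactSpace K := isCompact_iff_compactSpace.mp hK
  let coord : Fin n → C(K, ℝ) := fun i => ⟨fun x => x.1 i, (continuous_apply i).comp continuous_subtype_val⟩
  have hcoord (q : MvPolynomial (Fin n) ℝ) (x : K) :
      (MvPolynomial.aeval coord q) x = MvPolynomial.eval x.1 q := by
    induction q using MvPolynomial.induction_on with
    | C a => simp [MvPolynomial.algHom_C]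
    | add p q hp hq => simp [hp, hq]
    | mul_X p i hp => simp [hp, coord]
  have hsep : (MvPolynomial.aeval (R := ℝ) coord).range.SeparatesPoints := by
    intro x y hxy
    obtain ⟨i, hi⟩ := Function.ne_iff.mp (Subtype.coe_injective.ne hxy)
    exact ⟨coord i, ⟨coord i, ⟨MvPolynomial.X i, by simp⟩, rfl⟩, hi⟩
  obtain ⟨⟨_, q, rfl⟩, hq⟩ :=
    ContinuousMap.exists_mem_subalgebra_near_continuous_of_separatesPoints _ hsep
      (K.domRestrict f) hf.domRestrict ε hε
  refine ⟨q, fun x hx => ?_⟩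
  have h := hq ⟨x, hx⟩
  rw [Real.norm_eq_abs] at h
  exact (hcoord q ⟨x, hx⟩) ▸ h

/-- A random variable whose even moments grow at most like `C * R ^ (2 * k)` is almost surely
bounded. -/
theorem ae_abs_lt_of_even_moments_le {Ω : Type*} [MeasurableSpace Ω] {P : Measure Ω}
    [IsFiniteMeasure P] {Z : Ω → ℝ} {C R : ℝ} (hR : 0 ≤ R)
    (hint : ∀ k : ℕ, Integrable (fun ω => Z ω ^ (2 * k)) P)
    (hmom : ∀ k : ℕ, ∫ ω, Z ω ^ (2 * k) ∂P ≤ C * R ^ (2 * k)) :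
    ∀ᵐ ω ∂P, |Z ω| < R + 1 := by
  -- Markov's inequality for `Z ^ (2 * k)` at level `(R + 1) ^ (2 * k)`; the bound decays
  -- geometrically in `k`.
  have hpow (k : ℕ) : P.real {ω | R + 1 ≤ |Z ω|} ≤ C * ((R / (R + 1)) ^ 2) ^ k := by
    have hmarkov := mul_meas_ge_le_integral_of_nonneg (μ := P) (f := fun ω => Z ω ^ (2 * k))
      (ae_of_all _ fun ω => (even_two_mul k).pow_nonneg (Z ω)) (hint k) ((R + 1) ^ (2 * k))
    have hsub : P.real {ω | R + 1 ≤ |Z ω|} ≤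
        P.real {ω | (R + 1) ^ (2 * k) ≤ Z ω ^ (2 * k)} := by
      refine measureReal_mono fun ω (hω : R + 1 ≤ |Z ω|) => ?_
      rw [Set.mem_ofPred_eq, ← (even_two_mul k).pow_abs (Z ω)]
      gcongr
    have hpos : 0 < (R + 1) ^ (2 * k) := by positivity
    rw [← pow_mul, div_pow, ← mul_div_assoc, le_div_iff₀ hpos, mul_comm]
    exact (mul_le_mul_of_nonneg_left hsub hpos.le).trans (hmarkov.trans (hmom k))
  have hlim : Filter.Tendsto (fun k : ℕ => C * ((R / (R + 1)) ^ 2) ^ k) Filter.atTop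
      (nhds (C * 0)) := by
    refine (tendsto_pow_atTop_nhds_zero_of_lt_one (by positivity) ?_).const_mul C
    have : R / (R + 1) < 1 := (div_lt_one (by positivity)).mpr (lt_add_one R)
    exact pow_lt_one₀ (by positivity) this two_ne_zero
  have hzero : P.real {ω | R + 1 ≤ |Z ω|} ≤ 0 :=
    (ge_of_tendsto' hlim hpow).trans_eq (mul_zero C)
  have hnull : P {ω | R + 1 ≤ |Z ω|} = 0 :=
    (measureReal_eq_zero_iff).mp (le_antisymm hzero measureReal_nonneg)
  rw [ae_iff]
  simpa only [not_lt] using hnull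

section Moments

variable {Ω : Type*} [MeasurableSpace Ω] {P : Measure Ω} {n : ℕ} {G : Ω → Fin n → ℝ}

theorem eval_eq_sum_monomial (q : MvPolynomial (Fin n) ℝ) (x : Fin n → ℝ) :
    MvPolynomial.eval x q = ∑ m ∈ q.support, q.coeff m * monomial x m :=
  MvPolynomial.eval_eq' x q

theorem integrable_eval (hG : ∀ m : Fin n → ℕ, Integrable (fun ω => monomial (G ω) m) P)
    (q : MvPolynomial (Fin n) ℝ) : Integrable (fun ω => MvPolynomial.eval (G ω) q) P := by
  simp only [eval_eq_sum_monomial]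
  exact integrable_finsetSum _ fun m _ => (hG m).const_mul _

/-- If the expectations of polynomials in `G` are controlled by their suprema on a compact set `K`,
then `G` lies in `K` almost surely. -/
theorem ae_mem_of_integral_eval_le [IsProbabilityMeasure P]
    (hG : ∀ m : Fin n → ℕ, Integrable (fun ω => monomial (G ω) m) P)
    {K : Set (Fin n → ℝ)} (hK : IsCompact K) {C : ℝ}
    (hC : ∀ q : MvPolynomial (Fin n) ℝ, (∀ x ∈ K, |MvPolynomial.eval x q| ≤ 1) →
      ∫ ω, MvPolynomial.eval (G ω) q ∂P ≤ C) :
    ∀ᵐ ω ∂P, G ω ∈ K := by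
  have hint := integrable_eval hG
  rcases K.eq_empty_or_nonempty with rfl | hne
  -- On the empty set the bound on `q` is vacuous, so the constant `C + 1` contradicts `hC`. The
  -- distance argument below would fail here, as `infDist` to `∅` is `0`.
  · have h := hC (MvPolynomial.C (C + 1)) (by simp)
    simp at h
    linarith
  have hscale {M : ℝ} (hM : 0 < M) (q : MvPolynomial (Fin n) ℝ)
      (hq : ∀ x ∈ K, |MvPolynomial.eval x q| ≤ M) :
      ∫ ω, MvPolynomial.eval (G ω) q ∂P ≤ C * M := by
    have h := hC (MvPolynomial.C M⁻¹ * q) fun x hx => by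
      rw [map_mul, MvPolynomial.eval_C, abs_mul, abs_of_pos (inv_pos.mpr hM),
        inv_mul_le_iff₀ hM, mul_one]
      exact hq x hx
    simp only [map_mul, MvPolynomial.eval_C, integral_const_mul] at h
    rwa [inv_mul_le_iff₀ hM, mul_comm] at h
  obtain ⟨R, hR, hKR⟩ := hK.isBounded.exists_pos_norm_le
  -- Confining `G` to a ball makes polynomial approximation of the distance to `K` usable under the
  -- expectation.
  have hcube : ∀ᵐ ω ∂P, G ω ∈ Metric.closedBall (0 : Fin n → ℝ) (R + 1) := by
    have hcoord (i : Fin n) : ∀ᵐ ω ∂P, |G ω i| < R + 1 := by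
      refine ae_abs_lt_of_even_moments_le (C := C) hR.le (fun k => ?_) fun k => ?_
      · simpa using hint (MvPolynomial.X i ^ (2 * k))
      · have h := hscale (pow_pos hR (2 * k)) (MvPolynomial.X i ^ (2 * k)) fun x hx => by
          rw [map_pow, MvPolynomial.eval_X, abs_pow]
          exact pow_le_pow_left₀ (abs_nonneg _) ((norm_le_pi_norm x i).trans (hKR x hx)) _
        simpa using h
    filter_upwards [ae_all_iff.mpr hcoord] with ω hω
    rw [mem_closedBall_zero_iff, pi_norm_le_iff_of_nonneg (by positivity)]
    exact fun i => (hω i).le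
  have hmeas : AEMeasurable G P := aemeasurable_pi_lambda G fun i => by
    simpa using (hint (MvPolynomial.X i)).aestronglyMeasurable.aemeasurable
  have hcont : Continuous fun x : Fin n → ℝ => Metric.infDist x K :=
    Metric.continuous_infDist_pt K
  have hball : IsCompact (Metric.closedBall (0 : Fin n → ℝ) (R + 1)) :=
    isCompact_closedBall 0 (R + 1)
  obtain ⟨B, hB⟩ := hball.exists_bound_of_continuousOn hcont.continuousOn
  have hdist : Integrable (fun ω => Metric.infDist (G ω) K) P :=
    Integrable.of_bound (hcont.measurable.comp_aemeasurable hmeas).aestronglyMeasurable B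
      (hcube.mono fun ω hω => hB _ hω)
  -- The distance vanishes on `K`, so a polynomial `η`-close to it on the ball is at most `η` on `K`
  -- and has expectation at most `C * η`.
  have hle {η : ℝ} (hη : 0 < η) : ∫ ω, Metric.infDist (G ω) K ∂P ≤ (C + 1) * η := by
    obtain ⟨q, hq⟩ := exists_mvPolynomial_near hball hcont.continuousOn hη
    have hqK : ∀ x ∈ K, |MvPolynomial.eval x q| ≤ η := fun x hx => by
      have h := hq x (mem_closedBall_zero_iff.mpr ((hKR x hx).trans (by linarith)))
      rw [Metric.infDist_zero_of_mem hx, sub_zero] at h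
      exact h.le
    calc ∫ ω, Metric.infDist (G ω) K ∂P ≤ ∫ ω, (MvPolynomial.eval (G ω) q + η) ∂P := by
          refine integral_mono_ae hdist ((hint q).add (integrable_const η)) ?_
          filter_upwards [hcube] with ω hω
          linarith [(abs_lt.mp (hq _ hω)).1]
      _ = ∫ ω, MvPolynomial.eval (G ω) q ∂P + η := by
          rw [integral_add (hint q) (integrable_const η)]
          simp
      _ ≤ (C + 1) * η := by linarith [hscale hη q hqK]
  have hlim : Filter.Tendsto (fun η : ℝ => (C + 1) * η) (nhdsWithin 0 (Set.Ioi 0))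
      (nhds ((C + 1) * 0)) :=
    ((continuous_const_mul (C + 1)).tendsto 0).mono_left nhdsWithin_le_nhds
  have hzero : ∫ ω, Metric.infDist (G ω) K ∂P = 0 := by
    refine le_antisymm ?_ (integral_nonneg fun ω => Metric.infDist_nonneg)
    rw [mul_zero] at hlim
    exact ge_of_tendsto hlim (Filter.mem_of_superset self_mem_nhdsWithin fun η hη => hle hη)
  filter_upwards [(integral_eq_zero_iff_of_nonneg (fun ω => Metric.infDist_nonneg) hdist).mp hzero]
    with ω hω
  exact (hK.isClosed.mem_iff_infDist_zero hne).mpr hω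

/-- The expectation of `f(G)` and the values of `f` on a compact set `K` can be approximated
simultaneously by one polynomial. -/
theorem exists_mvPolynomial_integral_near [IsProbabilityMeasure P]
    (hG : ∀ m : Fin n → ℕ, Integrable (fun ω => monomial (G ω) m) P)
    {f : (Fin n → ℝ) → ℝ} (hfG : Integrable (fun ω => f (G ω)) P)
    {K : Set (Fin n → ℝ)} (hK : IsCompact K) (hf : ContinuousOn f K) {ε : ℝ} (hε : 0 < ε) :
    ∃ q : MvPolynomial (Fin n) ℝ,
      |∫ ω, f (G ω) ∂P - ∫ ω, MvPolynomial.eval (G ω) q ∂P| < ε ∧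
        ∀ x ∈ K, |f x - MvPolynomial.eval x q| < ε := by
  have hint := integrable_eval hG
  obtain ⟨q, hq⟩ := exists_mvPolynomial_near hK hf (half_pos hε)
  by_cases hmem : ∀ᵐ ω ∂P, G ω ∈ K
  · refine ⟨q, ?_, fun x hx => ?_⟩
    · rw [← integral_sub hfG (hint q), ← Real.norm_eq_abs]
      refine (norm_integral_le_of_norm_le_const (C := ε / 2) ?_).trans_lt ?_
      · filter_upwards [hmem] with ω hω
        rw [Real.norm_eq_abs, abs_sub_comm]
        exact (hq _ hω).le
      · simpa using hε
    · rw [abs_sub_comm]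
      exact (hq x hx).trans (half_lt_self hε)
  · set D := ∫ ω, f (G ω) ∂P - ∫ ω, MvPolynomial.eval (G ω) q ∂P with hD
    -- The threshold is chosen so that the correction factor `D / I` is smaller than `ε / 2`.
    obtain ⟨r, hrK, hr⟩ : ∃ r : MvPolynomial (Fin n) ℝ,
        (∀ x ∈ K, |MvPolynomial.eval x r| ≤ 1) ∧
          |D| / (ε / 2) < ∫ ω, MvPolynomial.eval (G ω) r ∂P := by
      by_contra! h
      exact hmem (ae_mem_of_integral_eval_le hG hK h)
    set I := ∫ ω, MvPolynomial.eval (G ω) r ∂P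
    have hI : 0 < I := lt_of_le_of_lt (by positivity) hr
    have hc : |D / I| < ε / 2 := by
      rw [abs_div, abs_of_pos hI, div_lt_iff₀ hI]
      rwa [div_lt_iff₀ (half_pos hε), mul_comm] at hr
    -- The added term has expectation exactly `D`, so the error in the price becomes zero.
    refine ⟨q + MvPolynomial.C (D / I) * r, ?_, fun x hx => ?_⟩
    · simp only [map_add, map_mul, MvPolynomial.eval_C]
      rw [integral_add (hint q) ((hint r).const_mul _), integral_const_mul, ← sub_sub, ← hD,
        div_mul_cancel₀ D hI.ne', sub_self, abs_zero]
      exact hε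
    · simp only [map_add, map_mul, MvPolynomial.eval_C]
      have h₁ := hq x hx
      have h₂ : |D / I * MvPolynomial.eval x r| ≤ |D / I| := by
        rw [abs_mul]
        exact mul_le_of_le_one_right (abs_nonneg _) (hrK x hx)
      rw [abs_lt] at h₁ ⊢
      rw [abs_le] at h₂
      constructor <;> linarith

end Moments

end SigPricing

theorem corollary5p2 {Ω : Type*} [MeasurableSpace Ω] (P : MeasureTheory.Measure Ω)
    [MeasureTheory.IsProbabilityMeasure P]
    (T p : ℝ) (hT : 0 < T) (hp : 1 ≤ p) (d : ℕ)
    -- the random time-extended price path, as a rough path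
    (X : Ω → SigPricing.TimeRoughPath T p d) (hX : Measurable X)
    -- the payoff, a function of finitely many signature coordinates
    (F : SigPricing.TimeRoughPath T p d → ℝ)
    (n : ℕ) (π : Fin n → SigPricing.WeightedWord (d + 1)) (f : (Fin n → ℝ) → ℝ)
    (hF : SigPricing.IsSignaturePayoff hT.le F π f)
    -- the price and the correlators are expectations that exist
    (hprice : MeasureTheory.Integrable (fun ω => F (X ω)) P)
    (hmoments : ∀ m : Fin n → ℕ, MeasureTheory.Integrable
      (fun ω => SigPricing.monomial (SigPricing.sigCoords hT.le π (X ω)) m) P) :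
    ∀ ε : ℝ, 0 < ε → ∀ K : Set (Fin n → ℝ), IsCompact K → ContinuousOn f K →
      ∃ (N : Finset (Fin n → ℕ)) (α : (Fin n → ℕ) → ℝ),
        |SigPricing.price P F X - ∑ m ∈ N, α m * SigPricing.correlator P hT.le π X m| < ε ∧
        ∀ Y : SigPricing.TimeRoughPath T p d, SigPricing.sigCoords hT.le π Y ∈ K →
          |F Y - ∑ m ∈ N, α m * SigPricing.monomial (SigPricing.sigCoords hT.le π Y) m| < ε := by
  intro ε hε K hK hfK
  obtain ⟨q, hprice_lt, hpayoff_lt⟩ := SigPricing.exists_mvPolynomial_integral_near hmoments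
    (by simpa only [hF.eq_comp] using hprice) hK hfK hε
  -- Exponents of an `MvPolynomial` are finitely supported functions, those of the correlators plain
  -- functions; over `Fin n` these coincide.
  let toFun : (Fin n →₀ ℕ) ↪ (Fin n → ℕ) := ⟨DFunLike.coe, DFunLike.coe_injective⟩
  let α : (Fin n → ℕ) → ℝ := fun m => q.coeff (Finsupp.equivFunOnFinite.symm m)
  have hsum (φ : (Fin n → ℕ) → ℝ) :
      ∑ m ∈ q.support.map toFun, α m * φ m = ∑ m ∈ q.support, q.coeff m * φ m := by
    simp [toFun, α]
  refine ⟨q.support.map toFun, α, ?_, fun Y hY => ?_⟩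
  · simp only [SigPricing.eval_eq_sum_monomial] at hprice_lt
    rw [MeasureTheory.integral_finsetSum _ fun (m : Fin n →₀ ℕ) _ =>
      (hmoments m).const_mul (q.coeff m)] at hprice_lt
    simp only [MeasureTheory.integral_const_mul] at hprice_lt
    simpa only [hsum, SigPricing.price, SigPricing.correlator, hF.eq_comp] using hprice_lt
  · rw [hsum, hF.eq_comp, ← SigPricing.eval_eq_sum_monomial]
    exact hpayoff_lt _ hY
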